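/- A circuit on a finite set of qubits is a sequence of layers, a layer being a collection of arbitrary one- and two-qubit unitary gates acting on pairwise disjoint sets of qubits; the depth of a circuit is its number of layers. Say that a circuit $W$ on $n+a$ qubits (the first $n$ are data qubits, the remaining $a$ are ancillas) realizes an $n$-qubit circuit $S$ with postselection if there is a constant $c\neq 0$ such that for every $n$-qubit input state $|v\rangle$ $$\left(I\otimes\langle 0|^{\otimes a}\right)\,W\,\left(|v\rangle\otimes|0\rangle^{\otimes a}\right)=c\,S|v\rangle ,$$ where $W$ and $S$ also denote the unitary operators of the circuits; that is, when all ancillas are measured and found in $|0\rangle$, which for $|v\rangle\neq 0$ happens with positive probability, the data qubits are left in a state proportional to the sequential output $S|v\rangle$. Corollary (Efficient parallelization). Any sequence of gates on $n$ qubits of depth $O(Mn^2)$, $M\ge 2$, can be represented, with postselection, by a circuit of depth $O(\log_2(M)\,n^2)$ acting on $O(Mn)$ qubits. Precisely: for every constant $C$ there is a constant $K$, depending only on $C$, such that for every $n\in\mathbb{N}$, every real $M\ge 2$ and every circuit $S$ on $n$ qubits of depth at most $C\,M\,n^2$, there are a number $a$ of ancillas and a circuit $W$ on $n+a$ qubits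 such that $W$ has depth at most $K\log_2(M)\,n^2$, $n+a\le K\,M\,n$, and $W$ realizes $S$ with postselection. -/

import Mathlib

namespace QCircuit

/-- Computational basis labels of a register whose qubits are indexed by `Q`. -/
abbrev Basis (Q : Type) : Type := Q → Fin 2

/-- (Not necessarily normalised) state vectors of a register with qubits `Q`:
amplitudes in the computational basis. -/
abbrev State (Q : Type) : Type := Basis Q → ℂ

/-- A one- or two-qubit gate: an arbitrary unitary acting on one or two qubits of the register. -/
structure Gate (Q : Type) [Fintype Q] [DecidableEq Q] where
  /-- the qubits on which the gate acts -/
  support : Finset Q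
  one_le_card : 1 ≤ support.card
  card_le_two : support.card ≤ 2
  /-- the unitary applied to these qubits -/
  unitary : Matrix.unitaryGroup (Basis support) ℂ

/-- The operator `u ⊗ I` of a gate on the whole register: `u` on the qubits of the support,
the identity on all other qubits. -/
def Gate.matrix {Q : Type} [Fintype Q] [DecidableEq Q] (g : Gate Q) :
    Matrix (Basis Q) (Basis Q) ℂ :=
  fun x y =>
    if ∀ q, q ∉ g.support → x q = y q then
      (g.unitary : Matrix (Basis g.support) (Basis g.support) ℂ) (fun q => x q) (fun q => y q)
    else 0

/-- A layer: gates executed simultaneously, acting on pairwise disjoint sets of qubits. -/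
structure Layer (Q : Type) [Fintype Q] [DecidableEq Q] where
  gates : List (Gate Q)
  pairwise_disjoint : gates.Pairwise (fun g h => Disjoint g.support h.support)

/-- The operator of a layer. The factors commute, since their supports are disjoint. -/
def Layer.matrix {Q : Type} [Fintype Q] [DecidableEq Q] (L : Layer Q) :
    Matrix (Basis Q) (Basis Q) ℂ :=
  (L.gates.map Gate.matrix).prod

/-- A circuit: a sequence of layers, the head of the list being executed first. -/
abbrev Circuit (Q : Type) [Fintype Q] [DecidableEq Q] : Type := List (Layer Q)

/-- The depth of a circuit is its number of sequential layers. -/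
def Circuit.depth {Q : Type} [Fintype Q] [DecidableEq Q] (W : Circuit Q) : ℕ := List.length W

/-- The operator of a circuit; the first layer is the rightmost factor. -/
def Circuit.matrix {Q : Type} [Fintype Q] [DecidableEq Q] (W : Circuit Q) :
    Matrix (Basis Q) (Basis Q) ℂ :=
  (List.map Layer.matrix W).reverse.prod

/-- The state obtained by running the circuit on the input state `ψ`. -/
def Circuit.run {Q : Type} [Fintype Q] [DecidableEq Q] (W : Circuit Q) (ψ : State Q) : State Q :=
  Matrix.mulVec (Circuit.matrix W) ψ

/-- The state `v ⊗ |0…0⟩`: the data qubits `D` carry `v`, every ancilla in `A` is `|0⟩`. -/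
def withZeroAncillas {D A : Type} [Fintype A] (v : State D) : State (D ⊕ A) :=
  fun z => if ∀ a : A, z (Sum.inr a) = 0 then v (fun q => z (Sum.inl q)) else 0

/-- Postselection on all ancilla measurements giving `0`: the (unnormalised) state
`(I ⊗ ⟨0…0|) ψ` of the data qubits. -/
def postselectZero {D A : Type} (ψ : State (D ⊕ A)) : State D :=
  fun x => ψ (Sum.elim x (fun _ => 0))

/-- The circuit `W` on the data qubits `D` and ancillas `A` realizes the operator of the circuit
`S` on `D` with postselection: for some nonzero amplitude `c` and every input state `v`, running
`W` on `v ⊗ |0…0⟩` and postselecting the outcomes `0…0` of the ancillas leaves the data qubits in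
`c` times the output of `S` on `v`. -/
def PostselectRealizes {D A : Type} [Fintype D] [DecidableEq D] [Fintype A] [DecidableEq A]
    (W : Circuit (D ⊕ A)) (S : Circuit D) : Prop :=
  ∃ c : ℂ, c ≠ 0 ∧ ∀ v : State D,
    postselectZero (Circuit.run W (withZeroAncillas v)) = c • Circuit.run S v

end QCircuit

/-! Sequential composition is traded for space by postselected gate teleportation. To apply `S` and
then `T`, run both at once, with `T` acting on one half of Bell pairs; then project the output of
`S` and the other halves onto Bell states. No Pauli correction arises, because only the trivial
outcome is kept. The contraction of the two Bell states is the sum over intermediate labels in the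
matrix product, up to a nonzero scalar (`postselectRealizes_teleport`).

One such step costs three layers whatever the depths are, so halving the circuit `k` times turns
depth `2 ^ k * B` into `B + 3 * k`, on fewer than `2 ^ k * (2 * n)` qubits when `n > 0`
(`exists_postselectRealizes`). The corollary takes `k = ⌈log₂ M⌉` and `B = ⌈C⌉₊ * n ^ 2`. -/

namespace QCircuit

/-! ### Operators on an embedded subregister -/

section Lift

variable {P Q R : Type}

open Classical in
/-- The operator `A ⊗ I` on a register `R` into which the register `Q` is embedded by `f`. -/
noncomputable def lift (f : Q ↪ R) (A : Matrix (Basis Q) (Basis Q) ℂ) :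
    Matrix (Basis R) (Basis R) ℂ :=
  fun x y => if ∀ r, r ∉ Set.range f → x r = y r then A (x ∘ f) (y ∘ f) else 0

theorem extend_comp_embedding (f : Q ↪ R) (w : Basis Q) (x : Basis R) :
    Function.extend f w x ∘ f = w :=
  funext fun q => f.injective.extend_apply w x q

theorem extend_apply_of_notMem (f : Q ↪ R) (w : Basis Q) (x : Basis R) {r : R}
    (hr : r ∉ Set.range f) : Function.extend f w x r = x r :=
  Function.extend_apply' _ _ _ fun ⟨q, hq⟩ => hr ⟨q, hq⟩

theorem extend_eq_of_agree (f : Q ↪ R) {x y : Basis R}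
    (h : ∀ r, r ∉ Set.range f → x r = y r) : Function.extend f (y ∘ f) x = y := by
  funext r
  by_cases hr : r ∈ Set.range f
  · obtain ⟨q, rfl⟩ := hr
    exact f.injective.extend_apply _ _ q
  · rw [extend_apply_of_notMem f _ _ hr, h r hr]

theorem lift_lift (f : P ↪ Q) (g : Q ↪ R) (A : Matrix (Basis P) (Basis P) ℂ) :
    lift g (lift f A) = lift (f.trans g) A := by
  ext x y
  have key : (∀ r, r ∉ Set.range (f.trans g) → x r = y r) ↔
      (∀ r, r ∉ Set.range g → x r = y r) ∧
        ∀ q, q ∉ Set.range f → (x ∘ g) q = (y ∘ g) q := by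
    constructor
    · refine fun h => ⟨fun r hr => h r ?_, fun q hq => h (g q) ?_⟩
      · rintro ⟨p, rfl⟩
        exact hr ⟨f p, rfl⟩
      · rintro ⟨p, hp⟩
        exact hq ⟨p, g.injective hp⟩
    · rintro ⟨h1, h2⟩ r hr
      by_cases hg : r ∈ Set.range g
      · obtain ⟨q, rfl⟩ := hg
        exact h2 q fun ⟨p, hp⟩ => hr ⟨p, by simp [← hp]⟩
      · exact h1 r hg
  by_cases h1 : ∀ r, r ∉ Set.range g → x r = y r
  · by_cases h2 : ∀ q, q ∉ Set.range f → (x ∘ g) q = (y ∘ g) q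
    · rw [lift, if_pos h1, lift, if_pos h2, lift, if_pos (key.2 ⟨h1, h2⟩)]
      rfl
    · rw [lift, if_pos h1, lift, if_neg h2, lift, if_neg fun h => h2 (key.1 h).2]
  · rw [lift, if_neg h1, lift, if_neg fun h => h1 (key.1 h).1]

variable [Fintype Q] [DecidableEq Q] [Fintype R] [DecidableEq R]

/-- Only labels agreeing with `x` outside the range of `f` contribute, and these are parametrized by
their restriction to `Q`. The algebra of lifts and the action of Bell and swap layers are computed
from this formula. -/
theorem lift_mulVec (f : Q ↪ R) (A : Matrix (Basis Q) (Basis Q) ℂ) (ψ : State R) (x : Basis R) :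
    (lift f A).mulVec ψ x = ∑ w, A (x ∘ f) w * ψ (Function.extend f w x) := by
  classical
  simp only [Matrix.mulVec, dotProduct, lift, ite_mul, zero_mul]
  rw [← Finset.sum_filter]
  refine Finset.sum_nbij' (fun y => y ∘ f) (fun w => Function.extend f w x) ?_ ?_ ?_ ?_ ?_
  · simp
  · intro w _
    simp only [Finset.mem_filter, Finset.mem_univ, true_and]
    exact fun r hr => (extend_apply_of_notMem f w x hr).symm
  · intro y hy
    exact extend_eq_of_agree f (Finset.mem_filter.1 hy).2
  · intro w _
    exact extend_comp_embedding f w x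
  · intro y hy
    rw [extend_eq_of_agree f (Finset.mem_filter.1 hy).2]

theorem matrix_eq_of_mulVec {A B : Matrix (Basis R) (Basis R) ℂ}
    (h : ∀ ψ x, A.mulVec ψ x = B.mulVec ψ x) : A = B := by
  exact Matrix.mulVec_injective (funext fun ψ => funext (h ψ))

theorem lift_mul (f : Q ↪ R) (A B : Matrix (Basis Q) (Basis Q) ℂ) :
    lift f (A * B) = lift f A * lift f B := by
  refine matrix_eq_of_mulVec fun ψ x => ?_
  rw [← Matrix.mulVec_mulVec]
  simp only [lift_mulVec, extend_comp_embedding, Matrix.mul_apply, Finset.sum_mul, Finset.mul_sum]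
  rw [Finset.sum_comm]
  refine Finset.sum_congr rfl fun w _ => Finset.sum_congr rfl fun z _ => ?_
  have : Function.extend f z (Function.extend f w x) = Function.extend f z x := by
    funext r
    by_cases hr : r ∈ Set.range f
    · obtain ⟨q, rfl⟩ := hr
      simp [f.injective.extend_apply]
    · simp only [extend_apply_of_notMem f _ _ hr]
  rw [this, mul_assoc]

theorem lift_one (f : Q ↪ R) : lift f (1 : Matrix (Basis Q) (Basis Q) ℂ) = 1 := by
  refine matrix_eq_of_mulVec fun ψ x => ?_
  rw [lift_mulVec, Matrix.one_mulVec, Finset.sum_eq_single (x ∘ f)]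
  · rw [Matrix.one_apply_eq, one_mul, extend_eq_of_agree f fun _ _ => rfl]
  · intro w _ hw
    rw [Matrix.one_apply_ne' hw, zero_mul]
  · simp

theorem lift_list_prod (f : Q ↪ R) (l : List (Matrix (Basis Q) (Basis Q) ℂ)) :
    lift f l.prod = (l.map (lift f)).prod := by
  induction l with
  | nil => simp [lift_one]
  | cons A l ih => simp [lift_mul, ih]

/-- Overwriting coordinates in one range neither affects the restriction to the other nor depends on
the order of the two overwritings, so the double sums agree. -/
theorem lift_commute {P : Type} [Fintype P] [DecidableEq P] (f : P ↪ R) (g : Q ↪ R)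
    (h : Disjoint (Set.range f) (Set.range g))
    (A : Matrix (Basis P) (Basis P) ℂ) (B : Matrix (Basis Q) (Basis Q) ℂ) :
    Commute (lift f A) (lift g B) := by
  refine matrix_eq_of_mulVec fun ψ x => ?_
  rw [← Matrix.mulVec_mulVec, ← Matrix.mulVec_mulVec]
  simp only [lift_mulVec, Finset.mul_sum]
  rw [Finset.sum_comm]
  refine Finset.sum_congr rfl fun w _ => Finset.sum_congr rfl fun z _ => ?_
  have hf : ∀ p, f p ∉ Set.range g := fun p hp => Set.disjoint_left.1 h ⟨p, rfl⟩ hp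
  have hg : ∀ q, g q ∉ Set.range f := fun q hq => Set.disjoint_left.1 h hq ⟨q, rfl⟩
  have h1 : Function.extend f z x ∘ g = x ∘ g :=
    funext fun q => extend_apply_of_notMem f z x (hg q)
  have h2 : Function.extend g w x ∘ f = x ∘ f :=
    funext fun p => extend_apply_of_notMem g w x (hf p)
  have h3 : Function.extend g w (Function.extend f z x) =
      Function.extend f z (Function.extend g w x) := by
    funext r
    by_cases hr : r ∈ Set.range g
    · obtain ⟨q, rfl⟩ := hr
      rw [g.injective.extend_apply, extend_apply_of_notMem f _ _ (hg q), g.injective.extend_apply]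
    · rw [extend_apply_of_notMem g _ _ hr]
      by_cases hr' : r ∈ Set.range f
      · obtain ⟨p, rfl⟩ := hr'
        simp only [f.injective.extend_apply]
      · simp only [extend_apply_of_notMem f _ _ hr', extend_apply_of_notMem g _ _ hr]
  rw [h1, h2, h3]
  ring

end Lift

/-! ### Transporting circuits along embeddings and running them in parallel -/

section Map

variable {Q R : Type} [Fintype Q] [DecidableEq Q] [Fintype R] [DecidableEq R]

theorem submatrix_mem_unitaryGroup {m k : Type} [Fintype m] [DecidableEq m] [Fintype k]
    [DecidableEq k] (e : k ≃ m) {u : Matrix m m ℂ} (hu : u ∈ Matrix.unitaryGroup m ℂ) :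
    u.submatrix e e ∈ Matrix.unitaryGroup k ℂ := by
  rw [Matrix.mem_unitaryGroup_iff, Matrix.star_eq_conjTranspose] at *
  rw [Matrix.conjTranspose_submatrix, Matrix.submatrix_mul_equiv, hu, Matrix.submatrix_one_equiv]

/-- The gate obtained by placing a gate on the image of an embedded register. -/
noncomputable def Gate.map (f : Q ↪ R) (g : Gate Q) : Gate R where
  support := g.support.map f
  one_le_card := by simpa using g.one_le_card
  card_le_two := by simpa using g.card_le_two
  unitary := ⟨_, submatrix_mem_unitaryGroup
    ((g.support.equivMap f).arrowCongr (Equiv.refl (Fin 2))).symm g.unitary.2⟩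

/-- A gate is itself the lift of its unitary along the inclusion of its support, so this reduces to
composition of embeddings. -/
theorem Gate.matrix_map (f : Q ↪ R) (g : Gate Q) : (g.map f).matrix = lift f g.matrix := by
  have h1 : ∀ {Q : Type} [Fintype Q] [DecidableEq Q] (g : Gate Q), g.matrix =
      lift (Function.Embedding.subtype (· ∈ g.support)) g.unitary.1 := by
    intro Q _ _ g
    ext x y
    simp only [Gate.matrix, lift, Subtype.range_coe_subtype, Set.mem_ofPred_eq,
      Function.Embedding.coe_subtype]
    rfl
  rw [h1 g, lift_lift]
  ext x y
  simp only [Gate.matrix, lift, Gate.map]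
  congr 1
  simp

/-- The layer obtained by placing a layer on the image of an embedded register. -/
noncomputable def Layer.map (f : Q ↪ R) (L : Layer Q) : Layer R where
  gates := L.gates.map (Gate.map f)
  pairwise_disjoint := by
    rw [List.pairwise_map]
    exact L.pairwise_disjoint.imp fun h => (Finset.disjoint_map f).2 h

theorem Layer.matrix_map (f : Q ↪ R) (L : Layer Q) : (L.map f).matrix = lift f L.matrix := by
  simp only [Layer.matrix, Layer.map, lift_list_prod, List.map_map]
  congr 2
  funext g
  exact Gate.matrix_map f g

theorem Circuit.matrix_nil : Circuit.matrix ([] : Circuit Q) = 1 := rfl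

theorem Circuit.matrix_cons (L : Layer Q) (W : Circuit Q) :
    Circuit.matrix (L :: W) = Circuit.matrix W * L.matrix := by
  simp [Circuit.matrix]

theorem Circuit.matrix_append (V W : Circuit Q) :
    Circuit.matrix (V ++ W) = Circuit.matrix W * Circuit.matrix V := by
  simp [Circuit.matrix]

theorem Circuit.matrix_map (f : Q ↪ R) (W : Circuit Q) :
    Circuit.matrix (List.map (Layer.map f) W) = lift f (Circuit.matrix W) := by
  induction W with
  | nil => simp [Circuit.matrix_nil, lift_one]
  | cons L W ih => simp [Circuit.matrix_cons, ih, Layer.matrix_map, lift_mul]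

variable {P : Type} [Fintype P] [DecidableEq P]

/-- Two layers executed simultaneously on disjoint parts of a register. -/
noncomputable def Layer.par (f : P ↪ R) (g : Q ↪ R) (h : Disjoint (Set.range f) (Set.range g))
    (L : Layer P) (N : Layer Q) : Layer R where
  gates := (L.map f).gates ++ (N.map g).gates
  pairwise_disjoint := by
    refine List.pairwise_append.2 ⟨(L.map f).pairwise_disjoint, (N.map g).pairwise_disjoint, ?_⟩
    simp only [Layer.map, List.mem_map]
    rintro _ ⟨a, _, rfl⟩ _ ⟨b, _, rfl⟩
    rw [Finset.disjoint_left]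
    simp only [Gate.map, Finset.mem_map]
    rintro _ ⟨p, _, rfl⟩ ⟨q, _, hq⟩
    exact Set.disjoint_left.1 h ⟨p, rfl⟩ ⟨q, hq⟩

theorem Layer.matrix_par (f : P ↪ R) (g : Q ↪ R) (h : Disjoint (Set.range f) (Set.range g))
    (L : Layer P) (N : Layer Q) :
    (Layer.par f g h L N).matrix = lift f L.matrix * lift g N.matrix := by
  rw [← Layer.matrix_map, ← Layer.matrix_map]
  simp [Layer.matrix, Layer.par]

/-- Two circuits executed simultaneously on disjoint parts of a register. -/
noncomputable def Circuit.par (f : P ↪ R) (g : Q ↪ R) (h : Disjoint (Set.range f) (Set.range g)) :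
    Circuit P → Circuit Q → Circuit R
  | [], W => List.map (Layer.map g) W
  | L :: V, [] => List.map (Layer.map f) (L :: V)
  | L :: V, N :: W => Layer.par f g h L N :: Circuit.par f g h V W

theorem Circuit.length_par (f : P ↪ R) (g : Q ↪ R) (h : Disjoint (Set.range f) (Set.range g))
    (V : Circuit P) (W : Circuit Q) :
    List.length (Circuit.par f g h V W) = max (List.length V) (List.length W) := by
  induction V, W using Circuit.par.induct <;> simp_all [Circuit.par]

theorem Circuit.matrix_par (f : P ↪ R) (g : Q ↪ R) (h : Disjoint (Set.range f) (Set.range g))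
    (V : Circuit P) (W : Circuit Q) : Circuit.matrix (Circuit.par f g h V W) =
      lift f (Circuit.matrix V) * lift g (Circuit.matrix W) := by
  induction V, W using Circuit.par.induct with
  | case1 W => simp [Circuit.par, Circuit.matrix_map, Circuit.matrix_nil, lift_one]
  | case2 L V =>
    rw [Circuit.par, Circuit.matrix_map, Circuit.matrix_nil, lift_one, mul_one]
  | case3 L V N W ih =>
    rw [Circuit.par, Circuit.matrix_cons, Circuit.matrix_cons, Circuit.matrix_cons, ih,
      Layer.matrix_par, lift_mul, lift_mul]
    simp only [mul_assoc]
    rw [← mul_assoc (lift g _) (lift f _), ← (lift_commute f g h _ _).eq, mul_assoc]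

end Map

/-! ### Bell and swap layers on two copies of a register -/

section Pairs

variable {D Q : Type} [Fintype D] [DecidableEq D] [Fintype Q] [DecidableEq Q]

/-- The two-qubit gate applying `u` to the qubits `a` and `b`. -/
def Gate.pair (a b : Q) (hab : a ≠ b) (u : Matrix.unitaryGroup (Fin 2 × Fin 2) ℂ) : Gate Q where
  support := {a, b}
  one_le_card := by simp [Finset.card_pair hab]
  card_le_two := by simp [Finset.card_pair hab]
  unitary := ⟨_, submatrix_mem_unitaryGroup (k := Basis ({a, b} : Finset Q))
    { toFun := fun x => (x ⟨a, by simp⟩, x ⟨b, by simp⟩)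
      invFun := fun p q => if q.1 = a then p.1 else p.2
      left_inv := by
        intro x
        funext ⟨q, hq⟩
        obtain rfl | rfl : q = a ∨ q = b := by simpa using hq
        · simp
        · simp [hab.symm]
      right_inv := by
        rintro ⟨i, j⟩
        simp [hab.symm] } u.2⟩

theorem Gate.matrix_pair (a b : Q) (hab : a ≠ b) (u : Matrix.unitaryGroup (Fin 2 × Fin 2) ℂ)
    (x y : Basis Q) : (Gate.pair a b hab u).matrix x y =
      if ∀ q, q ≠ a ∧ q ≠ b → x q = y q then u.1 (x a, x b) (y a, y b) else 0 := by
  simp [Gate.matrix, Gate.pair]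

/-- The layer applying `u` to every pair of corresponding qubits of two copies of `D`. -/
noncomputable def pairLayer (u : Matrix.unitaryGroup (Fin 2 × Fin 2) ℂ) : Layer (D ⊕ D) where
  gates := Finset.univ.toList.map fun q : D => Gate.pair (.inl q) (.inr q) (by simp) u
  pairwise_disjoint := by
    rw [List.pairwise_map]
    refine (Finset.nodup_toList _).imp fun {a b} hab => ?_
    simp [Gate.pair, hab.symm]

theorem matrix_pairs_prod (u : Matrix.unitaryGroup (Fin 2 × Fin 2) ℂ) (l : List D) (hl : l.Nodup)
    (x y : Basis (D ⊕ D)) :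
    (l.map fun q : D => (Gate.pair (Sum.inl q) (.inr q) (by simp) u).matrix).prod x y =
      if ∀ q, q ∉ l → x (.inl q) = y (.inl q) ∧ x (.inr q) = y (.inr q) then
        (l.map fun q => u.1 (x (.inl q), x (.inr q)) (y (.inl q), y (.inr q))).prod else 0 := by
  induction l generalizing x with
  | nil =>
    simp only [List.map_nil, List.prod_nil, Matrix.one_apply]
    congr 1
    simp [funext_iff, forall_and]
  | cons a l ih =>
    rw [List.nodup_cons] at hl
    simp only [List.map_cons, List.prod_cons, Matrix.mul_apply]
    -- The only intermediate label that contributes: the first gate allows changes only at the pair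
    -- `a`, the remaining gates only away from it.
    set z : Basis (D ⊕ D) := Function.update (Function.update x (.inl a) (y (.inl a)))
      (.inr a) (y (.inr a)) with hz
    have hzl : ∀ q, q ≠ a → z (.inl q) = x (.inl q) := fun q hq => by simp [hz, hq]
    have hzr : ∀ q, q ≠ a → z (.inr q) = x (.inr q) := fun q hq => by simp [hz, hq]
    have hza : z (.inl a) = y (.inl a) := by simp [hz]
    have hza' : z (.inr a) = y (.inr a) := by simp [hz]
    rw [Finset.sum_eq_single z]
    · rw [Gate.matrix_pair, if_pos, ih hl.2, mul_ite, mul_zero, hza, hza']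
      · congr 1
        · refine propext (forall_congr' fun q => ?_)
          by_cases hq : q = a
          · subst hq; simp [hza, hza']
          · simp [hq, hzl q hq, hzr q hq]
        · congr 2
          refine List.map_congr_left fun q hq => ?_
          have hqa : q ≠ a := fun h => hl.1 (h ▸ hq)
          rw [hzl q hqa, hzr q hqa]
      · rintro (q | q) ⟨h1, h2⟩
        · exact (hzl q (by simpa using h1)).symm
        · exact (hzr q (by simpa using h2)).symm
    · intro w _ hw
      rw [Gate.matrix_pair, ih hl.2]
      by_cases h1 : ∀ q, q ≠ Sum.inl a ∧ q ≠ Sum.inr a → x q = w q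
      · rw [if_neg (c := ∀ q, q ∉ l → _), mul_zero]
        intro h2
        apply hw
        funext q
        by_cases hq : q = .inl a
        · rw [hq, hza, (h2 a hl.1).1]
        by_cases hq' : q = .inr a
        · rw [hq', hza', (h2 a hl.1).2]
        · rw [← h1 q ⟨hq, hq'⟩, hz, Function.update_of_ne hq', Function.update_of_ne hq]
      · rw [if_neg h1, zero_mul]
    · simp

theorem pairLayer_matrix (u : Matrix.unitaryGroup (Fin 2 × Fin 2) ℂ) (x y : Basis (D ⊕ D)) :
    (pairLayer u).matrix x y =
      ∏ q, u.1 (x (.inl q), x (.inr q)) (y (.inl q), y (.inr q)) := by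
  rw [Layer.matrix, pairLayer, List.map_map]
  refine (matrix_pairs_prod u _ (Finset.nodup_toList _) x y).trans ?_
  rw [if_pos (by simp), Finset.prod_map_toList]

/-- A symmetric unitary mapping `|00⟩` to the Bell state `(|00⟩ + |11⟩) / √2`. -/
noncomputable def bellGate : Matrix.unitaryGroup (Fin 2 × Fin 2) ℂ :=
  ⟨Matrix.of fun p q => if p.1 = p.2 ∧ q.1 = q.2 then
      (if p.1 = 1 ∧ q.1 = 1 then -((Real.sqrt 2 : ℝ) : ℂ)⁻¹ else ((Real.sqrt 2 : ℝ) : ℂ)⁻¹)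
      else if p = q then 1 else 0, by
    have h : ((Real.sqrt 2 : ℝ) : ℂ)⁻¹ * ((Real.sqrt 2 : ℝ) : ℂ)⁻¹ = 1 / 2 := by
      rw [← mul_inv, ← Complex.ofReal_mul, Real.mul_self_sqrt (by norm_num)]
      norm_num
    rw [Matrix.mem_unitaryGroup_iff]
    ext ⟨i, j⟩ ⟨k, l⟩
    fin_cases i <;> fin_cases j <;> fin_cases k <;> fin_cases l <;>
      simp [Matrix.mul_apply, Fintype.sum_prod_type, Matrix.star_apply, h] <;>
      norm_num⟩

theorem bellGate_zero_right (i j : Fin 2) :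
    bellGate.1 (i, j) (0, 0) = if i = j then ((Real.sqrt 2 : ℝ) : ℂ)⁻¹ else 0 := by
  fin_cases i <;> fin_cases j <;> simp [bellGate]

/-- By symmetry of the gate, its `00` row is a Bell state as well: applying it and keeping outcome
`00` is a Bell projection. -/
theorem bellGate_zero_left (i j : Fin 2) :
    bellGate.1 (0, 0) (i, j) = if i = j then ((Real.sqrt 2 : ℝ) : ℂ)⁻¹ else 0 := by
  fin_cases i <;> fin_cases j <;> simp [bellGate]

/-- The gate exchanging two qubits. -/
def swapGate : Matrix.unitaryGroup (Fin 2 × Fin 2) ℂ :=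
  ⟨(1 : Matrix (Fin 2 × Fin 2) (Fin 2 × Fin 2) ℂ).submatrix Prod.swap id, by
    rw [Matrix.mem_unitaryGroup_iff]
    ext ⟨i, j⟩ ⟨k, l⟩
    fin_cases i <;> fin_cases j <;> fin_cases k <;> fin_cases l <;>
      simp [Matrix.mul_apply, Matrix.star_apply, Matrix.one_apply]⟩

theorem swapGate_apply (i j k l : Fin 2) :
    swapGate.1 (i, j) (k, l) = if k = j ∧ l = i then 1 else 0 := by
  simp [swapGate, Matrix.one_apply, eq_comm]

theorem prod_ite_eq_fun {P : Type} [Fintype P] (s : ℂ) (x y : Basis P) :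
    (∏ q, if x q = y q then s else 0) = if x = y then s ^ Fintype.card P else 0 := by
  by_cases h : x = y
  · simp [h]
  · obtain ⟨q, hq⟩ := Function.ne_iff.1 h
    rw [if_neg h, Finset.prod_eq_zero (Finset.mem_univ q) (if_neg hq)]

theorem sum_basis_sum {A B : Type} [Fintype A] [Fintype B] [DecidableEq A] [DecidableEq B]
    (F : Basis (A ⊕ B) → ℂ) : ∑ w, F w = ∑ x : Basis A, ∑ y : Basis B, F (Sum.elim x y) := by
  rw [← Fintype.sum_prod_type',
    ← (Equiv.sumArrowEquivProdArrow A B (Fin 2)).symm.sum_comp]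
  rfl

/-- Bell pair preparation: `hψ` says that the pairs start in `|00⟩`, so only that column of each
gate is seen. -/
theorem bell_mulVec (f : D ⊕ D ↪ Q) (ψ : State Q) (x : Basis Q)
    (hψ : ∀ y z, ψ (Function.extend f (Sum.elim y z) x) ≠ 0 → y = 0 ∧ z = 0) :
    (((pairLayer bellGate : Layer (D ⊕ D)).map f).matrix).mulVec ψ x =
      if x ∘ f ∘ Sum.inl = x ∘ f ∘ Sum.inr then
        ((Real.sqrt 2 : ℝ) : ℂ)⁻¹ ^ Fintype.card D * ψ (Function.extend f (Sum.elim 0 0) x)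
      else 0 := by
  rw [Layer.matrix_map, lift_mulVec, sum_basis_sum, Finset.sum_eq_single 0, Finset.sum_eq_single 0]
  · rw [pairLayer_matrix]
    simp only [Function.comp_apply, Sum.elim_inl, Sum.elim_inr, Pi.zero_apply,
      bellGate_zero_right]
    rw [prod_ite_eq_fun _ (fun q => x (f (Sum.inl q))) (fun q => x (f (Sum.inr q))), ite_mul,
      zero_mul]
    rfl
  · intro z _ hz
    by_contra h
    exact hz (hψ _ _ (right_ne_zero_of_mul h)).2
  · simp
  · intro y _ hy
    refine Finset.sum_eq_zero fun z _ => ?_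
    by_contra h
    exact hy (hψ _ _ (right_ne_zero_of_mul h)).1
  · simp

/-- Bell measurement: at outcome zero the layer contracts the two copies of `D` along the diagonal.
-/
theorem bell_mulVec_of_zero (f : D ⊕ D ↪ Q) (ψ : State Q) (x : Basis Q)
    (hx : ∀ q, x (f q) = 0) :
    (((pairLayer bellGate : Layer (D ⊕ D)).map f).matrix).mulVec ψ x =
      ((Real.sqrt 2 : ℝ) : ℂ)⁻¹ ^ Fintype.card D *
        ∑ y : Basis D, ψ (Function.extend f (Sum.elim y y) x) := by
  rw [Layer.matrix_map, lift_mulVec, sum_basis_sum, Finset.mul_sum]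
  refine Finset.sum_congr rfl fun y _ => ?_
  simp only [pairLayer_matrix, Function.comp_apply, hx, Sum.elim_inl, Sum.elim_inr,
    bellGate_zero_left, prod_ite_eq_fun, ite_mul, zero_mul]
  simp

theorem swap_mulVec (f : D ⊕ D ↪ Q) (ψ : State Q) (x : Basis Q) :
    (((pairLayer swapGate : Layer (D ⊕ D)).map f).matrix).mulVec ψ x =
      ψ (Function.extend f (Sum.elim (x ∘ f ∘ Sum.inr) (x ∘ f ∘ Sum.inl)) x) := by
  rw [Layer.matrix_map, lift_mulVec, sum_basis_sum, Finset.sum_eq_single (x ∘ f ∘ Sum.inr),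
    Finset.sum_eq_single (x ∘ f ∘ Sum.inl)]
  · simp [pairLayer_matrix, swapGate_apply]
  · intro z _ hz
    obtain ⟨q, hq⟩ := Function.ne_iff.1 hz
    rw [pairLayer_matrix, Finset.prod_eq_zero (Finset.mem_univ q), zero_mul]
    rw [swapGate_apply, if_neg fun h => hq h.2]
  · simp
  · intro y _ hy
    obtain ⟨q, hq⟩ := Function.ne_iff.1 hy
    refine Finset.sum_eq_zero fun z _ => ?_
    rw [pairLayer_matrix, Finset.prod_eq_zero (Finset.mem_univ q), zero_mul]
    rw [swapGate_apply, if_neg fun h => hq h.1]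
  · simp

end Pairs

/-! ### Postselection in terms of matrix entries -/

section Postselection

variable {D A : Type} [Fintype D] [DecidableEq D] [Fintype A] [DecidableEq A]

theorem postselectZero_run (W : Circuit (D ⊕ A)) (v : State D) (x : Basis D) :
    postselectZero (Circuit.run W (withZeroAncillas v)) x =
      ∑ y, Circuit.matrix W (Sum.elim x 0) (Sum.elim y 0) * v y := by
  simp only [postselectZero, Circuit.run, Matrix.mulVec, dotProduct]
  rw [sum_basis_sum]
  refine Finset.sum_congr rfl fun y _ => ?_
  rw [Finset.sum_eq_single 0]
  · exact congrArg _ (if_pos fun _ => rfl)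
  · intro z _ hz
    rw [withZeroAncillas, if_neg, mul_zero]
    exact fun h => hz (funext h)
  · simp

/-- Testing on basis states turns realization into proportionality of the block of `W` with all
ancillas zero before and after. -/
theorem postselectRealizes_iff (W : Circuit (D ⊕ A)) (S : Circuit D) :
    PostselectRealizes W S ↔ ∃ c : ℂ, c ≠ 0 ∧ ∀ x y,
      Circuit.matrix W (Sum.elim x 0) (Sum.elim y 0) = c * Circuit.matrix S x y := by
  refine exists_congr fun c => and_congr_right fun _ => ⟨fun h x y => ?_, fun h v => ?_⟩
  · have := congrFun (h (Pi.single y 1)) x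
    rw [postselectZero_run] at this
    simpa [Circuit.run, Pi.single_apply] using this
  · funext x
    rw [postselectZero_run]
    simp [h, Circuit.run, Matrix.mulVec, dotProduct, Finset.mul_sum, mul_assoc]

theorem postselectRealizes_map_inl (S : Circuit D) :
    PostselectRealizes (A := A) (List.map (Layer.map Function.Embedding.inl) S) S := by
  refine (postselectRealizes_iff _ _).2 ⟨1, one_ne_zero, fun x y => ?_⟩
  rw [Circuit.matrix_map, lift, if_pos, one_mul]
  · rfl
  · rintro (q | q) hq
    · exact absurd ⟨q, rfl⟩ hq
    · rfl

theorem postselectRealizes_reindex {B : Type} [Fintype B] [DecidableEq B] (e : A ≃ B)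
    (W : Circuit (D ⊕ A)) (S : Circuit D) (h : PostselectRealizes W S) :
    PostselectRealizes
      (List.map (Layer.map ((Equiv.refl D).sumCongr e).toEmbedding) W) S := by
  rw [postselectRealizes_iff] at h ⊢
  obtain ⟨c, hc, h⟩ := h
  refine ⟨c, hc, fun x y => ?_⟩
  rw [Circuit.matrix_map, lift, if_pos, ← h]
  · congr 1 <;> funext q <;> cases q <;> rfl
  · intro r hr
    exact absurd (((Equiv.refl D).sumCongr e).surjective r) hr

end Postselection

/-! ### Composition by teleportation, and its iteration -/

section Teleportation

variable {D A B : Type}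

/-- The register of two postselected computations, with data qubits `D` each and ancillas `A` and
`B` respectively, and a further copy of `D`. -/
abbrev TeleportRegister (D A B : Type) : Type := D ⊕ (A ⊕ ((D ⊕ B) ⊕ D))

/-- The basis label with the given components. -/
def teleportBasis (d : Basis D) (a : Basis A) (e : Basis D) (b : Basis B) (r : Basis D) :
    Basis (TeleportRegister D A B) :=
  Sum.elim d (Sum.elim a (Sum.elim (Sum.elim e b) r))

/-- The part of the register holding the first computation. -/
def firstPart : D ⊕ A ↪ TeleportRegister D A B :=
  ⟨Sum.elim .inl (.inr ∘ .inl), by rintro (p | p) (q | q) h <;> simp_all⟩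

/-- The part of the register holding the second computation. -/
def secondPart : D ⊕ B ↪ TeleportRegister D A B :=
  ⟨.inr ∘ .inr ∘ .inl, by intro p q h; simpa using h⟩

/-- The data qubits of the second computation, paired with the further copy of `D`. -/
def sourcePairs : D ⊕ D ↪ TeleportRegister D A B :=
  ⟨Sum.elim (.inr ∘ .inr ∘ .inl ∘ .inl) (.inr ∘ .inr ∘ .inr), by
    rintro (p | p) (q | q) h <;> simp_all⟩

/-- The data qubits of the first computation, paired with the further copy of `D`. -/
def measuredPairs : D ⊕ D ↪ TeleportRegister D A B :=
  ⟨Sum.elim .inl (.inr ∘ .inr ∘ .inr), by rintro (p | p) (q | q) h <;> simp_all⟩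

/-- The data qubits of the two computations, paired. -/
def dataPairs : D ⊕ D ↪ TeleportRegister D A B :=
  ⟨Sum.elim .inl (.inr ∘ .inr ∘ .inl ∘ .inl), by rintro (p | p) (q | q) h <;> simp_all⟩

theorem disjoint_parts :
    Disjoint (Set.range (firstPart : D ⊕ A ↪ TeleportRegister D A B))
      (Set.range (secondPart : D ⊕ B ↪ TeleportRegister D A B)) := by
  rw [Set.disjoint_left]
  rintro _ ⟨p | p, rfl⟩ ⟨q, h⟩ <;> cases h

theorem extend_eq_of_comp {Q R : Type} (f : Q ↪ R) {w : Basis Q} {x z : Basis R}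
    (hz : z ∘ f = w) (h : ∀ r, r ∉ Set.range f → x r = z r) : Function.extend f w x = z :=
  hz ▸ extend_eq_of_agree f h

variable (d a e b r)

theorem extend_firstPart (d' : Basis D) (a' : Basis A) :
    Function.extend (firstPart : D ⊕ A ↪ TeleportRegister D A B) (Sum.elim d' a')
      (teleportBasis d a e b r) = teleportBasis d' a' e b r := by
  refine extend_eq_of_comp _ (by funext q; rcases q with q | q <;> rfl) ?_
  rintro (q | q | (q | q) | q) h <;>
    first | rfl | exact (h ⟨.inl q, rfl⟩).elim | exact (h ⟨.inr q, rfl⟩).elim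

theorem extend_secondPart (e' : Basis D) (b' : Basis B) :
    Function.extend (secondPart : D ⊕ B ↪ TeleportRegister D A B) (Sum.elim e' b')
      (teleportBasis d a e b r) = teleportBasis d a e' b' r := by
  refine extend_eq_of_comp _ (by funext q; rcases q with q | q <;> rfl) ?_
  rintro (q | q | (q | q) | q) h <;>
    first | rfl | exact (h ⟨.inl q, rfl⟩).elim | exact (h ⟨.inr q, rfl⟩).elim

theorem extend_sourcePairs (e' r' : Basis D) :
    Function.extend (sourcePairs : D ⊕ D ↪ TeleportRegister D A B) (Sum.elim e' r')
      (teleportBasis d a e b r) = teleportBasis d a e' b r' := by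
  refine extend_eq_of_comp _ (by funext q; rcases q with q | q <;> rfl) ?_
  rintro (q | q | (q | q) | q) h <;>
    first | rfl | exact (h ⟨.inl q, rfl⟩).elim | exact (h ⟨.inr q, rfl⟩).elim

theorem extend_measuredPairs (d' r' : Basis D) :
    Function.extend (measuredPairs : D ⊕ D ↪ TeleportRegister D A B) (Sum.elim d' r')
      (teleportBasis d a e b r) = teleportBasis d' a e b r' := by
  refine extend_eq_of_comp _ (by funext q; rcases q with q | q <;> rfl) ?_
  rintro (q | q | (q | q) | q) h <;>
    first | rfl | exact (h ⟨.inl q, rfl⟩).elim | exact (h ⟨.inr q, rfl⟩).elim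

theorem extend_dataPairs (d' e' : Basis D) :
    Function.extend (dataPairs : D ⊕ D ↪ TeleportRegister D A B) (Sum.elim d' e')
      (teleportBasis d a e b r) = teleportBasis d' a e' b r := by
  refine extend_eq_of_comp _ (by funext q; rcases q with q | q <;> rfl) ?_
  rintro (q | q | (q | q) | q) h <;>
    first | rfl | exact (h ⟨.inl q, rfl⟩).elim | exact (h ⟨.inr q, rfl⟩).elim

variable {d a e b r}
variable [Fintype D] [Fintype A] [Fintype B]

theorem withZeroAncillas_teleportBasis (v : State D) (d : Basis D) (a : Basis A) (e : Basis D)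
    (b : Basis B) (r : Basis D) : withZeroAncillas v (teleportBasis d a e b r) =
      if a = 0 ∧ e = 0 ∧ b = 0 ∧ r = 0 then v d else 0 := by
  have h : (∀ q : A ⊕ ((D ⊕ B) ⊕ D), teleportBasis d a e b r (Sum.inr q) = 0) ↔
      (a = 0 ∧ e = 0 ∧ b = 0 ∧ r = 0) := by
    simp [teleportBasis, Sum.forall, funext_iff, and_assoc]
  rw [withZeroAncillas]
  exact if_congr h rfl rfl

variable [DecidableEq D] [DecidableEq A] [DecidableEq B]

/-- The circuit running `V` and `W` simultaneously, where the data qubits of `W` are initially in a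
Bell state with a further copy of `D`, which is then postselected to be in a Bell state with the
data qubits of `V`. Finally the output of `W` is swapped into the data qubits. -/
noncomputable def teleport (V : Circuit (D ⊕ A)) (W : Circuit (D ⊕ B)) :
    Circuit (TeleportRegister D A B) :=
  (pairLayer bellGate).map sourcePairs ::
    (Circuit.par firstPart secondPart disjoint_parts V W ++
      [(pairLayer bellGate).map measuredPairs, (pairLayer swapGate).map dataPairs])

theorem depth_teleport (V : Circuit (D ⊕ A)) (W : Circuit (D ⊕ B)) :
    Circuit.depth (teleport V W) = max (Circuit.depth V) (Circuit.depth W) + 3 := by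
  simp [Circuit.depth, teleport, Circuit.length_par]

theorem bell_source_mulVec (v : State D) (d : Basis D) (a : Basis A) (e : Basis D)
    (b : Basis B) (r : Basis D) :
    (((pairLayer bellGate).map sourcePairs).matrix).mulVec (withZeroAncillas v)
      (teleportBasis d a e b r) =
      if e = r ∧ a = 0 ∧ b = 0 then ((Real.sqrt 2 : ℝ) : ℂ)⁻¹ ^ Fintype.card D * v d else 0 := by
  rw [bell_mulVec, extend_sourcePairs, withZeroAncillas_teleportBasis]
  · change (if e = r then _ else _) = _
    by_cases h : e = r <;> by_cases ha : a = 0 <;> by_cases hb : b = 0 <;> simp [h, ha, hb]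
  · intro y z h
    rw [extend_sourcePairs, withZeroAncillas_teleportBasis] at h
    by_contra h'
    exact h (if_neg fun hh => h' ⟨hh.2.1, hh.2.2.2⟩)

/-- The Bell preparation makes the input label of `T` equal to the label `r` of the further copy;
the Bell projection identifies `r` with the output label of `S` and sums over it, which is matrix
multiplication. -/
theorem postselectRealizes_teleport (V : Circuit (D ⊕ A)) (W : Circuit (D ⊕ B)) (S T : Circuit D)
    (hV : PostselectRealizes V S) (hW : PostselectRealizes W T) :
    PostselectRealizes (teleport V W) (S ++ T) := by
  rw [postselectRealizes_iff] at hV hW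
  obtain ⟨c, hc, hV⟩ := hV
  obtain ⟨c', hc', hW⟩ := hW
  set s : ℂ := ((Real.sqrt 2 : ℝ) : ℂ)⁻¹ ^ Fintype.card D with hs
  have hs0 : s ≠ 0 := by simp [hs]
  -- One factor `s` comes from preparing the Bell pairs, the other from projecting onto them.
  refine ⟨s * s * c * c', by simp [hs0, hc, hc'], fun v => ?_⟩
  -- The amplitude just before the Bell projection: `x` is the output label of `S`, `x'` that of
  -- `T`, and `r` the input label of `T`.
  have hmid : ∀ x x' r : Basis D, (lift firstPart (Circuit.matrix V)).mulVec
      ((lift secondPart (Circuit.matrix W)).mulVec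
        ((((pairLayer bellGate).map sourcePairs).matrix).mulVec (withZeroAncillas v)))
      (teleportBasis x (0 : Basis A) x' (0 : Basis B) r) =
      ∑ y, c * Circuit.matrix S x y * (c' * Circuit.matrix T x' r * (s * v y)) := by
    intro x x' r
    rw [lift_mulVec, sum_basis_sum]
    refine Finset.sum_congr rfl fun y _ => ?_
    rw [Finset.sum_eq_single 0]
    · rw [extend_firstPart, lift_mulVec, sum_basis_sum]
      congr 1
      · rw [← hV]
        congr 1
        funext q; rcases q with q | q <;> rfl
      rw [Finset.sum_eq_single r, Finset.sum_eq_single 0]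
      · rw [extend_secondPart, bell_source_mulVec, if_pos ⟨rfl, rfl, rfl⟩, ← hW]
        congr 2
      · intro b' _ hb'
        rw [extend_secondPart, bell_source_mulVec, if_neg fun h => hb' h.2.2, mul_zero]
      · simp
      · intro e' _ he'
        refine Finset.sum_eq_zero fun b' _ => ?_
        rw [extend_secondPart, bell_source_mulVec, if_neg fun h => he' h.1, mul_zero]
      · simp
    · intro a' _ ha'
      rw [extend_firstPart, lift_mulVec, sum_basis_sum, Finset.sum_eq_zero, mul_zero]
      refine fun e' _ => Finset.sum_eq_zero fun b' _ => ?_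
      rw [extend_secondPart, bell_source_mulVec, if_neg fun h => ha' h.2.1, mul_zero]
    · simp
  funext x
  have hx : (Sum.elim x (fun _ => 0) : Basis (TeleportRegister D A B)) =
      teleportBasis x 0 0 0 0 := by
    funext q; rcases q with q | q | (q | q) | q <;> rfl
  rw [postselectZero, hx, Circuit.run, teleport, Circuit.matrix_cons, Circuit.matrix_append,
    Circuit.matrix_cons, Circuit.matrix_cons, Circuit.matrix_nil, Circuit.matrix_par, one_mul]
  simp only [← Matrix.mulVec_mulVec]
  -- Undoing the swap moves `x` to the data qubits of the second computation and leaves zeros on the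
  -- measured pairs.
  rw [swap_mulVec, extend_dataPairs]
  change Matrix.mulVec _ _ (teleportBasis 0 0 x 0 0) = _
  rw [bell_mulVec_of_zero]
  · simp only [extend_measuredPairs, hmid]
    rw [Pi.smul_apply, Circuit.run, Circuit.matrix_append, ← Matrix.mulVec_mulVec]
    simp only [Matrix.mulVec, dotProduct, Finset.mul_sum, smul_eq_mul]
    refine Finset.sum_congr rfl fun y _ => Finset.sum_congr rfl fun z _ => ?_
    ring
  · rintro (q | q) <;> rfl

/-- Induction by cutting the circuit in two. Teleportation uses `|A₁| + |A₂| + 2|D|` ancillas, so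
the number of ancillas plus `2|D|` exactly doubles at each step. -/
theorem exists_postselectRealizes (B k : ℕ) (S : Circuit D) (hS : Circuit.depth S ≤ 2 ^ k * B) :
    ∃ (A : Type) (_ : Fintype A) (_ : DecidableEq A) (W : Circuit (D ⊕ A)),
      Circuit.depth W ≤ B + 3 * k ∧
      Fintype.card A + 2 * Fintype.card D = 2 ^ k * (2 * Fintype.card D) ∧
      PostselectRealizes W S := by
  induction k generalizing S with
  | zero =>
    refine ⟨Empty, inferInstance, inferInstance, _, ?_, by simp, postselectRealizes_map_inl S⟩
    simpa [Circuit.depth] using hS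
  | succ k ih =>
    obtain ⟨A₁, _, _, V, hV, hA₁, hVS⟩ := ih (S.take (2 ^ k * B)) (by simp [Circuit.depth])
    obtain ⟨A₂, _, _, W, hW, hA₂, hWS⟩ := ih (S.drop (2 ^ k * B)) (by
      simp only [Circuit.depth, List.length_drop] at hS ⊢
      rw [pow_succ, mul_right_comm] at hS
      omega)
    refine ⟨_, inferInstance, inferInstance, teleport V W, ?_, ?_, ?_⟩
    · rw [depth_teleport]
      omega
    · simp only [Fintype.card_sum, pow_succ]
      rw [mul_right_comm]
      omega
    · have := postselectRealizes_teleport V W _ _ hVS hWS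
      rwa [List.take_append_drop] at this

theorem exists_postselectRealizes_fin (B k : ℕ) (S : Circuit D)
    (hS : Circuit.depth S ≤ 2 ^ k * B) :
    ∃ (a : ℕ) (W : Circuit (D ⊕ Fin a)), Circuit.depth W ≤ B + 3 * k ∧
      a + 2 * Fintype.card D = 2 ^ k * (2 * Fintype.card D) ∧ PostselectRealizes W S := by
  obtain ⟨A, _, _, W, hW, hA, h⟩ := exists_postselectRealizes B k S hS
  refine ⟨Fintype.card A, _, ?_, hA, postselectRealizes_reindex (Fintype.equivFin A) W S h⟩
  simpa [Circuit.depth] using hW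

end Teleportation

end QCircuit

/-! ### Choice of parameters -/

theorem corollary1 (C : ℝ) :
    ∃ K : ℝ, ∀ (n : ℕ) (M : ℝ), 2 ≤ M →
      ∀ S : QCircuit.Circuit (Fin n),
        (QCircuit.Circuit.depth S : ℝ) ≤ C * (M * (n : ℝ) ^ 2) →
        ∃ (a : ℕ) (W : QCircuit.Circuit (Fin n ⊕ Fin a)),
          (QCircuit.Circuit.depth W : ℝ) ≤ K * (Real.logb 2 M * (n : ℝ) ^ 2) ∧
          ((n + a : ℕ) : ℝ) ≤ K * (M * (n : ℝ)) ∧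
          QCircuit.PostselectRealizes W S := by
  -- The `6` bounds the overhead `3 * k`, as `k ≤ log₂ M + 1 ≤ 2 * log₂ M`; for the width `4` would
  -- do. The natural ceiling also covers negative `C`.
  refine ⟨⌈C⌉₊ + 6, fun n M hM S hS => ?_⟩
  -- For `n = 0` the depth bound is zero and leaves no room for the overhead `3 * k`, so no halving
  -- is done.
  rcases Nat.eq_zero_or_pos n with rfl | hn
  · have h0 : QCircuit.Circuit.depth S = 0 := by
      have : (QCircuit.Circuit.depth S : ℝ) ≤ 0 := by simpa using hS
      exact_mod_cast le_antisymm this (Nat.cast_nonneg _)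
    obtain ⟨a, W, hW, ha, h⟩ :=
      QCircuit.exists_postselectRealizes_fin 0 0 S (by simp [h0])
    refine ⟨a, W, ?_, ?_, h⟩
    · have : QCircuit.Circuit.depth W = 0 := by omega
      simp [this]
    · have : a = 0 := by simpa using ha
      simp [this]
  have hM0 : (0 : ℝ) < M := by linarith
  have hn1 : (1 : ℝ) ≤ n := by exact_mod_cast hn
  have hlog : 1 ≤ Real.logb 2 M := by
    rw [Real.le_logb_iff_rpow_le one_lt_two hM0]
    simpa using hM
  set k := ⌈Real.logb 2 M⌉₊ with hk
  have hkl : (k : ℝ) ≤ Real.logb 2 M + 1 := (Nat.ceil_lt_add_one (by linarith)).le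
  have hMk : M ≤ 2 ^ k := by
    rw [← Real.rpow_natCast, ← Real.logb_le_iff_le_rpow one_lt_two hM0]
    exact Nat.le_ceil _
  have hkM : (2 : ℝ) ^ k ≤ 2 * M := by
    calc (2 : ℝ) ^ k = (2 : ℝ) ^ (k : ℝ) := (Real.rpow_natCast _ _).symm
      _ ≤ (2 : ℝ) ^ (Real.logb 2 M + 1) := Real.rpow_le_rpow_of_exponent_le one_le_two hkl
      _ = 2 * M := by
        rw [Real.rpow_add two_pos, Real.rpow_logb two_pos (by norm_num) hM0, Real.rpow_one,
          mul_comm]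
  obtain ⟨a, W, hW, ha, h⟩ :=
    QCircuit.exists_postselectRealizes_fin (⌈C⌉₊ * n ^ 2) k S (by
      have : (QCircuit.Circuit.depth S : ℝ) ≤ 2 ^ k * (⌈C⌉₊ * (n : ℝ) ^ 2) := by
        calc (QCircuit.Circuit.depth S : ℝ) ≤ C * (M * (n : ℝ) ^ 2) := hS
          _ ≤ ⌈C⌉₊ * (2 ^ k * (n : ℝ) ^ 2) := by
            gcongr
            exact Nat.le_ceil C
          _ = _ := by ring
      exact_mod_cast this)
  refine ⟨a, W, ?_, ?_, h⟩
  · have hW' : (QCircuit.Circuit.depth W : ℝ) ≤ ⌈C⌉₊ * (n : ℝ) ^ 2 + 3 * k := by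
      exact_mod_cast hW
    have hn2 : (1 : ℝ) ≤ (n : ℝ) ^ 2 := one_le_pow₀ hn1
    have h1 : (n : ℝ) ^ 2 ≤ Real.logb 2 M * (n : ℝ) ^ 2 := le_mul_of_one_le_left (by positivity) hlog
    have h2 : Real.logb 2 M ≤ Real.logb 2 M * (n : ℝ) ^ 2 :=
      le_mul_of_one_le_right (by linarith) hn2
    have h3 : (⌈C⌉₊ : ℝ) * (n : ℝ) ^ 2 ≤ ⌈C⌉₊ * (Real.logb 2 M * (n : ℝ) ^ 2) := by gcongr
    linarith
  · have ha' : (a : ℝ) + 2 * n = 2 ^ k * (2 * n) := by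
      rw [Fintype.card_fin] at ha
      exact_mod_cast ha
    have h1 : (2 : ℝ) ^ k * (2 * n) ≤ 2 * M * (2 * n) := by gcongr
    have h2 : 0 ≤ (⌈C⌉₊ : ℝ) * (M * n) := by positivity
    have h3 : 0 ≤ M * (n : ℝ) := by positivity
    push_cast
    linarith
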